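/- Let $(X,\mathcal B,\mu,T)$ and $(Y,\mathcal D,\nu,S)$ be probability spaces with measure-preserving transformations, where $T$ is invertible (a bijection with measurable inverse) and $S$ is ergodic. If every $\tau\in \mathrm{Dims}_\mu(X,T)$ satisfies $\tau>\overline D_\nu(Y,S)$, then the two systems are disjoint: the product measure $\mu\times\nu$ is the only $T\times S$-invariant probability measure on $(X\times Y,\mathcal B\times\mathcal D)$ with marginals $\mu$ and $\nu$. Here the notions are defined as follows. For an increasing sequence $\mathbf s=\{s_1<s_2<\cdots\}$ of positive integers, put $$\overline D(\mathbf s)=\inf\Big\{\tau\ge 0:\ \limsup_{n\to\infty}\frac{n}{s_n^{\tau}}=0\Big\}.$$ For a finite measurable partition $\alpha$ of $X$, the sequence $\mathbf s$ is an entropy generating sequence of $\alpha$ if $\liminf_{n\to\infty}\frac1n H_\mu\big(\bigvee_{i=1}^n T^{-s_i}\alpha\big)>0$, where $H_\mu$ denotes Shannon entropy. The upper entropy dimension $\overline D_\mu(T,\alpha)$ is the supremum of $\overline D(\mathbf s)$ over all entropy generating sequences $\mathbf s$ of $\alpha$ (and $0$ if there are none). The upper entropy dimension of the system is $\overline D_\mu(X,T)=\sup_\alpha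 \overline D_\mu(T,\alpha)$, the supremum over all finite measurable partitions $\alpha$ of $X$; $\overline D_\nu(Y,S)$ is defined in the same way. The dimension set is $$\mathrm{Dims}_\mu(X,T)=\big\{\overline D_\mu(T,\{A,X\setminus A\}):\ A\in\mathcal B,\ 0<\mu(A)<1\big\}.$$ -/

import Mathlib

open MeasureTheory Filter
open scoped ENNReal NNReal

namespace EntropyDimension

universe u v

/-- An increasing sequence `s 0 < s 1 < ⋯` of positive integers; `s i` plays the role of the
`(i+1)`-st element of the sequence. -/
structure IsIncreasingSeq (s : ℕ → ℕ) : Prop where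
  strictMono : StrictMono s
  pos : ∀ i, 0 < s i

/-- `limsup_{n → ∞} n / (s_n) ^ τ`, with values in `[0, ∞]`. -/
noncomputable def upperDensity (s : ℕ → ℕ) (τ : ℝ≥0) : ℝ≥0∞ :=
  limsup (fun i : ℕ => ((i + 1 : ℕ) : ℝ≥0∞) / ((s i : ℕ) : ℝ≥0∞) ^ (τ : ℝ)) atTop

/-- The upper dimension of the sequence `s`: the infimum of all `τ ≥ 0` such that
`limsup_{n → ∞} n / (s_n) ^ τ = 0`. -/
noncomputable def upperDimSeq (s : ℕ → ℕ) : ℝ≥0∞ :=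
  ⨅ (τ : ℝ≥0) (_ : upperDensity s τ = 0), (τ : ℝ≥0∞)

section Partitions

variable {X : Type u}

/-- The Shannon entropy of the finite partition of `X` into the level sets of `f : X → ι`
(empty level sets contribute `0`). -/
noncomputable def partitionEntropy [MeasurableSpace X] (μ : Measure X) {ι : Type*} [Fintype ι]
    (f : X → ι) : ℝ :=
  ∑ a, Real.negMulLog (μ.real (f ⁻¹' {a}))

/-- The join `⋁_{i < n} T^{-s i} α` of preimages of the partition `α`, where `α` is given by its
labelling map: two points lie in the same cell of the join iff `T^{s i} x` and `T^{s i} y` lie in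
the same cell of `α` for all `i < n`. -/
def joinAlong (T : X → X) {k : ℕ} (α : X → Fin k) (s : ℕ → ℕ) (n : ℕ) : X → (Fin n → Fin k) :=
  fun x i => α (T^[s i] x)

/-- The two-set partition `{A, X \ A}`. -/
noncomputable def twoSetPartition (A : Set X) : X → Fin 2 :=
  open Classical in fun x => if x ∈ A then 0 else 1

variable [MeasurableSpace X]

/-- `s` is an entropy generating sequence of the finite partition `α`:
`liminf_{n → ∞} (1 / n) H_μ(⋁_{i=1}^n T^{-s_i} α) > 0`. -/
def IsEntropyGenerating (μ : Measure X) (T : X → X) {k : ℕ} (α : X → Fin k) (s : ℕ → ℕ) : Prop :=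
  IsIncreasingSeq s ∧
    0 < liminf (fun n : ℕ =>
      ENNReal.ofReal (partitionEntropy μ (joinAlong T α s n) / (n : ℝ))) atTop

/-- The upper entropy dimension of the finite partition `α`: the supremum of the upper dimensions
of its entropy generating sequences (`0` if there are none). -/
noncomputable def upperEntropyDimPartition (μ : Measure X) (T : X → X) {k : ℕ} (α : X → Fin k) :
    ℝ≥0∞ :=
  ⨆ (s : ℕ → ℕ) (_ : IsEntropyGenerating μ T α s), upperDimSeq s

/-- The upper metric entropy dimension of the system: the supremum of the upper entropy dimensions
of all finite measurable partitions. -/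
noncomputable def upperEntropyDim (μ : Measure X) (T : X → X) : ℝ≥0∞ :=
  ⨆ (k : ℕ) (α : X → Fin k) (_ : Measurable α), upperEntropyDimPartition μ T α

/-- The dimension set of the system. -/
def dimensionSet (μ : Measure X) (T : X → X) : Set ℝ≥0∞ :=
  {d | ∃ A : Set X, MeasurableSet A ∧ 0 < μ A ∧ μ A < 1 ∧
    d = upperEntropyDimPartition μ T (twoSetPartition A)}

end Partitions

section Joinings

variable {X : Type u} {Y : Type v} [MeasurableSpace X] [MeasurableSpace Y]

/-- `lam` is a joining of `(X, μ, T)` and `(Y, ν, S)`: a probability measure on `X × Y`, invariant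
under `T × S`, with marginals `μ` and `ν`. -/
structure IsJoining (μ : Measure X) (T : X → X) (ν : Measure Y) (S : Y → Y)
    (lam : Measure (X × Y)) : Prop where
  isProbabilityMeasure : IsProbabilityMeasure lam
  invariant : MeasurePreserving (Prod.map T S) lam lam
  map_fst : lam.map Prod.fst = μ
  map_snd : lam.map Prod.snd = ν

/-- Two systems are disjoint if the product measure is their only joining. -/
def AreDisjoint (μ : Measure X) (T : X → X) (ν : Measure Y) (S : Y → Y) : Prop :=
  {lam : Measure (X × Y) | IsJoining μ T ν S lam} = {μ.prod ν}

end Joinings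

end EntropyDimension

/-! Fix a joining and a set B in Y, and let g(x) be the conditional probability of B given x. If g
is a.e. constant for every B, the joining is the product. Otherwise some A = {g > c} is a nontrivial
set whose level {g = c} is null, and the point is that {A, X \ A} cannot be more complex than {B, Y
\ B}.

Given x, draw m conditionally independent copies of the B-itinerary. By equivariance, B occurs at
time i with conditional probability g(T^i x), so comparing its frequency among the copies with c
decides whether T^i x lies in A, with error probability small uniformly in i. Each copy has the law
of the itinerary under ν, so along any s the entropy for A is at most m times that for B plus nε
(`exists_entropy_le`). Hence generating sequences for A generate for B
(`IsEntropyGenerating.of_entropy_le`), against the dimension hypothesis at A.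

Conditioning the itinerary rather than the point of Y keeps the fibre space standard Borel although
Y is arbitrary. -/

namespace EntropyDimension

/-! ### Shannon entropy of finite partitions -/

section Entropy

variable {Z : Type*} [MeasurableSpace Z] (ρ : Measure Z)

lemma negMulLog_sum_le {ι : Type*} (s : Finset ι) (p : ι → ℝ) (hp : ∀ i ∈ s, 0 ≤ p i) :
    Real.negMulLog (∑ i ∈ s, p i) ≤ ∑ i ∈ s, Real.negMulLog (p i) := by
  simp only [Real.negMulLog, neg_mul, ← Finset.sum_neg_distrib, Finset.sum_mul]
  refine Finset.sum_le_sum fun i hi => neg_le_neg ?_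
  rcases (hp i hi).eq_or_lt with h | h
  · simp [← h]
  · exact mul_le_mul_of_nonneg_left (Real.log_le_log h (Finset.single_le_sum hp hi)) h.le

lemma partitionEntropy_nonneg [IsProbabilityMeasure ρ] {ι : Type*} [Fintype ι] (f : Z → ι) :
    0 ≤ partitionEntropy ρ f :=
  Finset.sum_nonneg fun _ _ => Real.negMulLog_nonneg measureReal_nonneg measureReal_le_one

lemma measureReal_comp_preimage [IsFiniteMeasure ρ] {ι κ : Type*} [Fintype ι] [DecidableEq κ]
    [MeasurableSpace ι] [MeasurableSingletonClass ι] {f : Z → ι} (hf : Measurable f)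
    (g : ι → κ) (b : κ) :
    ρ.real ((fun z => g (f z)) ⁻¹' {b}) = ∑ a with g a = b, ρ.real (f ⁻¹' {a}) := by
  rw [← measureReal_biUnion_finset]
  · congr 1
    ext z
    simp
  · intro a _ a' _ h
    exact (Set.disjoint_singleton.2 h).preimage f
  · exact fun a _ => hf (measurableSet_singleton a)

lemma sum_measureReal_preimage [IsProbabilityMeasure ρ] {ι : Type*} [Fintype ι]
    [MeasurableSpace ι] [MeasurableSingletonClass ι] {f : Z → ι} (hf : Measurable f) :
    ∑ a, ρ.real (f ⁻¹' {a}) = 1 := by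
  have := measureReal_comp_preimage ρ hf (fun _ => ()) ()
  simpa using this.symm

lemma partitionEntropy_comp_le [IsFiniteMeasure ρ] {ι κ : Type*} [Fintype ι] [Fintype κ]
    [MeasurableSpace ι] [MeasurableSingletonClass ι] {f : Z → ι} (hf : Measurable f)
    (g : ι → κ) : partitionEntropy ρ (fun z => g (f z)) ≤ partitionEntropy ρ f := by
  classical
  unfold partitionEntropy
  rw [← Finset.sum_fiberwise Finset.univ g]
  refine Finset.sum_le_sum fun b _ => ?_
  rw [measureReal_comp_preimage ρ hf]
  exact negMulLog_sum_le _ _ fun _ _ => measureReal_nonneg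

/-- This is log t ≤ t - 1 at t = pq/r, multiplied by r. Summed over a joint distribution the
correction pq - r cancels, which gives subadditivity of entropy. -/
lemma negMulLog_le_of_marginals {r p q : ℝ} (hr : 0 ≤ r) (hp : r ≤ p) (hq : r ≤ q) :
    Real.negMulLog r ≤ -(r * Real.log p) + -(r * Real.log q) + (p * q - r) := by
  rcases hr.eq_or_lt with h | h
  · subst h
    simpa using mul_nonneg hp hq
  · have hp' := h.trans_le hp
    have hq' := h.trans_le hq
    have h1 := Real.log_le_sub_one_of_pos (x := p * q / r) (by positivity)
    rw [Real.log_div (by positivity) h.ne', Real.log_mul hp'.ne' hq'.ne'] at h1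
    have h2 := mul_le_mul_of_nonneg_left h1 hr
    have h3 : r * (p * q / r - 1) = p * q - r := by field_simp
    rw [h3] at h2
    simp only [Real.negMulLog]
    linarith

lemma partitionEntropy_prodMk_le [IsProbabilityMeasure ρ] {ι κ : Type*} [Fintype ι] [Fintype κ]
    [MeasurableSpace ι] [MeasurableSingletonClass ι] [MeasurableSpace κ]
    [MeasurableSingletonClass κ] {f : Z → ι} {g : Z → κ} (hf : Measurable f) (hg : Measurable g) :
    partitionEntropy ρ (fun z => (f z, g z)) ≤ partitionEntropy ρ f + partitionEntropy ρ g := by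
  classical
  have hfg := hf.prodMk hg
  set r : ι × κ → ℝ := fun c => ρ.real ((fun z => (f z, g z)) ⁻¹' {c}) with hr
  set p : ι → ℝ := fun a => ρ.real (f ⁻¹' {a}) with hp
  set q : κ → ℝ := fun b => ρ.real (g ⁻¹' {b}) with hq
  have hrp : ∀ a, p a = ∑ b, r (a, b) := by
    intro a
    have := measureReal_comp_preimage ρ hfg Prod.fst a
    rw [hp]
    refine this.trans ?_
    rw [Finset.sum_filter, Fintype.sum_prod_type]
    rw [Finset.sum_eq_single a (by simp +contextual) (by simp)]
    simp [hr]
  have hrq : ∀ b, q b = ∑ a, r (a, b) := by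
    intro b
    have := measureReal_comp_preimage ρ hfg Prod.snd b
    rw [hq]
    refine this.trans ?_
    rw [Finset.sum_filter, Fintype.sum_prod_type]
    refine Finset.sum_congr rfl fun a _ => ?_
    simp [hr]
  have hr0 : ∀ c, 0 ≤ r c := fun _ => measureReal_nonneg
  have hp1 : ∑ a, p a = 1 := sum_measureReal_preimage ρ hf
  have hq1 : ∑ b, q b = 1 := sum_measureReal_preimage ρ hg
  have hr1 : ∑ c, r c = 1 := sum_measureReal_preimage ρ hfg
  have key : ∀ c : ι × κ, Real.negMulLog (r c) ≤ -(r c * Real.log (p c.1)) +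
      -(r c * Real.log (q c.2)) + (p c.1 * q c.2 - r c) := fun c =>
    negMulLog_le_of_marginals (hr0 c)
      (by rw [hrp]; exact Finset.single_le_sum (f := fun b => r (c.1, b)) (fun _ _ => hr0 _)
            (Finset.mem_univ c.2))
      (by rw [hrq]; exact Finset.single_le_sum (f := fun a => r (a, c.2)) (fun _ _ => hr0 _)
            (Finset.mem_univ c.1))
  have hsum := Finset.sum_le_sum fun c (_ : c ∈ Finset.univ) => key c
  rw [Finset.sum_add_distrib, Finset.sum_add_distrib, Finset.sum_sub_distrib, hr1] at hsum
  have e1 : ∑ c : ι × κ, p c.1 * q c.2 = 1 := by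
    rw [Fintype.sum_prod_type]
    simp [← Finset.mul_sum, hq1, hp1]
  have e2 : ∑ c : ι × κ, -(r c * Real.log (p c.1)) = ∑ a, Real.negMulLog (p a) := by
    rw [Fintype.sum_prod_type]
    refine Finset.sum_congr rfl fun a _ => ?_
    dsimp only
    rw [Finset.sum_neg_distrib, ← Finset.sum_mul, ← hrp, Real.negMulLog, neg_mul]
  have e3 : ∑ c : ι × κ, -(r c * Real.log (q c.2)) = ∑ b, Real.negMulLog (q b) := by
    rw [Fintype.sum_prod_type_right]
    refine Finset.sum_congr rfl fun b _ => ?_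
    dsimp only
    rw [Finset.sum_neg_distrib, ← Finset.sum_mul, ← hrq, Real.negMulLog, neg_mul]
  rw [e1, e2, e3, sub_self, add_zero] at hsum
  exact hsum

lemma partitionEntropy_pi_le [IsProbabilityMeasure ρ] {κ : Type*} [Fintype κ]
    [MeasurableSpace κ] [MeasurableSingletonClass κ] {n : ℕ} {f : Fin n → Z → κ}
    (hf : ∀ i, Measurable (f i)) :
    partitionEntropy ρ (fun z i => f i z) ≤ ∑ i, partitionEntropy ρ (f i) := by
  induction n with
  | zero =>
    have : ∀ a : Fin 0 → κ, (fun z (i : Fin 0) => f i z) ⁻¹' {a} = Set.univ := fun a => by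
      ext z
      simpa using Subsingleton.elim _ _
    simp [partitionEntropy, this]
  | succ n ih =>
    have h0 := hf 0
    have h1 : Measurable fun z (i : Fin n) => f i.succ z := measurable_pi_lambda _ fun i => hf _
    have h2 := partitionEntropy_comp_le ρ (h0.prodMk h1)
      (fun c => (Fin.cons c.1 c.2 : Fin (n + 1) → κ))
    have h3 : (fun z => (Fin.cons (f 0 z) (fun i : Fin n => f i.succ z) : Fin (n + 1) → κ)) =
        fun z i => f i z := by
      funext z i
      refine Fin.cases ?_ (fun _ => ?_) i <;> simp
    rw [h3] at h2
    rw [Fin.sum_univ_succ]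
    exact h2.trans ((partitionEntropy_prodMk_le ρ h0 h1).trans
      (add_le_add_right (ih fun i => hf i.succ) _))

lemma partitionEntropy_bool [IsProbabilityMeasure ρ] {f : Z → Bool} (hf : Measurable f) :
    partitionEntropy ρ f = Real.binEntropy (ρ.real (f ⁻¹' {true})) := by
  have h := sum_measureReal_preimage ρ hf
  rw [Fintype.sum_bool] at h
  rw [partitionEntropy, Fintype.sum_bool, Real.binEntropy_eq_negMulLog_add_negMulLog_one_sub,
    ← h, add_sub_cancel_left]

/-- If the coordinates of `P` are approximated by functions of `R 1, …, R m`, then the entropy of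
`P` is at most the total entropy of the `R j` plus the entropies of the approximation errors. -/
lemma partitionEntropy_le_of_approx [IsProbabilityMeasure ρ] {W : Type*} [Fintype W]
    [MeasurableSpace W] [MeasurableSingletonClass W] {m n : ℕ} {P : Z → Fin n → Fin 2}
    (hP : Measurable P) {R : Fin m → Z → W} (hR : ∀ j, Measurable (R j))
    (Φ : (Fin m → W) → Fin n → Fin 2) :
    partitionEntropy ρ P ≤ ∑ j, partitionEntropy ρ (R j) +
      ∑ i, Real.binEntropy (ρ.real {z | P z i ≠ Φ (fun j => R j z) i}) := by
  have hR' : Measurable fun z j => R j z := measurable_pi_lambda _ hR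
  let E : Fin n → Z → Bool := fun i z => decide (P z i ≠ Φ (fun j => R j z) i)
  have hE : ∀ i, Measurable (E i) := fun i =>
    (measurable_of_finite fun c : (Fin n → Fin 2) × (Fin m → W) => decide (c.1 i ≠ Φ c.2 i)).comp
      (hP.prodMk hR')
  have hE' : Measurable fun z i => E i z := measurable_pi_lambda _ hE
  -- The prediction and its error bits determine `P`: flip the predicted letter wherever the bit is
  -- set.
  have h1 := partitionEntropy_comp_le ρ (hR'.prodMk hE')
    (fun c i => if c.2 i then 1 - Φ c.1 i else Φ c.1 i)
  have h2 : (fun z i => if E i z then 1 - Φ (fun j => R j z) i else Φ (fun j => R j z) i) = P := by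
    funext z i
    simp only [E, decide_eq_true_eq]
    generalize P z i = a
    generalize Φ (fun j => R j z) i = b
    revert a b
    decide
  rw [h2] at h1
  have h3 : ∀ i, partitionEntropy ρ (E i) =
      Real.binEntropy (ρ.real {z | P z i ≠ Φ (fun j => R j z) i}) := fun i => by
    rw [partitionEntropy_bool ρ (hE i)]
    congr 2
    ext z
    simp [E]
  simp only [← h3]
  exact h1.trans ((partitionEntropy_prodMk_le ρ hR' hE').trans
    (add_le_add (partitionEntropy_pi_le ρ hR) (partitionEntropy_pi_le ρ hE)))

lemma partitionEntropy_congr {Z' : Type*} [MeasurableSpace Z'] {ρ' : Measure Z'} {ι : Type*}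
    [Fintype ι] {f : Z → ι} {g : Z' → ι} (h : ∀ a, ρ (f ⁻¹' {a}) = ρ' (g ⁻¹' {a})) :
    partitionEntropy ρ f = partitionEntropy ρ' g := by
  simp only [partitionEntropy, Measure.real, h]

end Entropy

/-! ### Itineraries of a two-set partition -/

open ProbabilityTheory Topology

lemma measurable_twoSetPartition {X : Type*} [MeasurableSpace X] {A : Set X}
    (hA : MeasurableSet A) : Measurable (twoSetPartition A) := by
  classical
  exact Measurable.ite hA measurable_const measurable_const

lemma twoSetPartition_eq_zero_iff {X : Type*} {A : Set X} {x : X} :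
    twoSetPartition A x = 0 ↔ x ∈ A := by
  simp [twoSetPartition]

lemma measurable_joinAlong {X : Type*} [MeasurableSpace X] {T : X → X} (hT : Measurable T) {k : ℕ}
    {α : X → Fin k} (hα : Measurable α) (s : ℕ → ℕ) (n : ℕ) : Measurable (joinAlong T α s n) :=
  measurable_pi_lambda _ fun _ => hα.comp (hT.iterate _)

/-- The full itinerary of a point with respect to the partition `{B, Y \ B}`. -/
noncomputable def itinerary {Y : Type*} (S : Y → Y) (B : Set Y) (y : Y) : ℕ → Fin 2 :=
  fun i => twoSetPartition B (S^[i] y)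

lemma measurable_itinerary {Y : Type*} [MeasurableSpace Y] {S : Y → Y} (hS : Measurable S)
    {B : Set Y} (hB : MeasurableSet B) : Measurable (itinerary S B) :=
  measurable_pi_lambda _ fun _ => (measurable_twoSetPartition hB).comp (hS.iterate _)

/-- The sequences over two letters whose letter at time `i` is `0`. -/
def zeroAt (i : ℕ) : Set (ℕ → Fin 2) := {w | w i = 0}

lemma measurableSet_zeroAt (i : ℕ) : MeasurableSet (zeroAt i) :=
  measurable_pi_apply i (measurableSet_singleton 0)

lemma itinerary_preimage_zeroAt {Y : Type*} (S : Y → Y) (B : Set Y) (i : ℕ) :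
    itinerary S B ⁻¹' zeroAt i = S^[i] ⁻¹' B := by
  ext y
  simp [itinerary, zeroAt, twoSetPartition_eq_zero_iff]

/-! ### Conditional itineraries over the first factor -/

section Disintegration

variable {X Y : Type*} [MeasurableSpace X] [MeasurableSpace Y] {μ : Measure X} {ν : Measure Y}
  {S : Y → Y} {lam : Measure (X × Y)}

/-- The conditional distributions of the itinerary of the second coordinate given the first. -/
lemma exists_kernel_itinerary [IsProbabilityMeasure μ] {T : X → X} (hlam : IsJoining μ T ν S lam)
    (hS : Measurable S) {B : Set Y} (hB : MeasurableSet B) :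
    ∃ κ : Kernel X (ℕ → Fin 2), IsMarkovKernel κ ∧
      ∀ A, MeasurableSet A → ∀ C, MeasurableSet C →
        ∫⁻ x in A, κ x C ∂μ = lam (A ×ˢ (itinerary S B ⁻¹' C)) := by
  have := hlam.isProbabilityMeasure
  have hφ := measurable_itinerary hS hB
  have hm : Measurable (Prod.map id (itinerary S B) : X × Y → X × (ℕ → Fin 2)) :=
    measurable_id.prodMap hφ
  have hp : IsProbabilityMeasure (lam.map (Prod.map id (itinerary S B))) :=
    Measure.isProbabilityMeasure_map hm.aemeasurable
  have hfst : (lam.map (Prod.map id (itinerary S B))).fst = μ := by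
    rw [Measure.fst, Measure.map_map measurable_fst hm, ← hlam.map_fst]
    rfl
  refine ⟨(lam.map (Prod.map id (itinerary S B))).condKernel, inferInstance, fun A hA C hC => ?_⟩
  have := Measure.setLIntegral_condKernel_eq_measure_prod
    (ρ := lam.map (Prod.map id (itinerary S B))) hA hC
  rw [hfst, Measure.map_apply hm (hA.prod hC), Set.preimage_prod_map_prod] at this
  simpa using this

/-- Equivariance of the conditional distributions; this uses that `T` is invertible. -/
lemma kernel_itinerary_equivariant [IsProbabilityMeasure μ] {T : X ≃ᵐ X}
    (hT : MeasurePreserving T μ μ) (hlam : IsJoining μ T ν S lam) {B : Set Y}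
    (hB : MeasurableSet B) {κ : Kernel X (ℕ → Fin 2)}
    (hκ : ∀ A, MeasurableSet A → ∀ C, MeasurableSet C →
      ∫⁻ x in A, κ x C ∂μ = lam (A ×ˢ (itinerary S B ⁻¹' C))) (i : ℕ) :
    ∀ᵐ x ∂μ, κ x (zeroAt i) = κ (T^[i] x) (zeroAt 0) := by
  have hTi := hT.iterate i
  have h0 := κ.measurable_coe (measurableSet_zeroAt 0)
  refine ae_eq_of_forall_setLIntegral_eq_of_sigmaFinite
    (κ.measurable_coe (measurableSet_zeroAt i)) (h0.comp hTi.measurable) fun A hA _ => ?_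
  -- Invertibility writes any test set as T^{-i}A', so invariance of the joining can be applied to
  -- A' × B.
  let A' : Set X := T.symm^[i] ⁻¹' A
  have hA' : MeasurableSet A' := T.symm.measurable.iterate i hA
  have hAA' : T^[i] ⁻¹' A' = A := by
    have : Function.LeftInverse T.symm T := T.symm_apply_apply
    rw [← Set.preimage_comp, (this.iterate i).comp_eq_id, Set.preimage_id]
  have h1 := hTi.setLIntegral_comp_preimage hA' h0
  rw [hAA'] at h1
  change _ = ∫⁻ x in A, κ (T^[i] x) (zeroAt 0) ∂μ
  rw [h1, hκ _ hA _ (measurableSet_zeroAt i), hκ _ hA' _ (measurableSet_zeroAt 0),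
    itinerary_preimage_zeroAt, itinerary_preimage_zeroAt, Function.iterate_zero, Set.preimage_id,
    ← (hlam.invariant.iterate i).measure_preimage (hA'.prod hB).nullMeasurableSet,
    Prod.map_iterate, Set.preimage_prod_map_prod, hAA']

end Disintegration

/-! ### Frequency estimates and choice of the level -/

/-- The weak law of large numbers for the frequency of visits to `D`, in quantitative form. -/
lemma measure_pi_frequency_le.{u} {U : Type u} [MeasurableSpace U] (P : Measure U)
    [IsProbabilityMeasure P] {D : Set U} (hD : MeasurableSet D) {m : ℕ} (hm : 0 < m) {η : ℝ}
    (hη : 0 < η) :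
    (Measure.pi fun _ : Fin m => P) {u : Fin m → U | m * η ≤ |(∑ j, D.indicator (fun _ => (1 : ℝ)) (u j)) -
      m * P.real D|} ≤ ENNReal.ofReal (1 / (m * η ^ 2)) := by
  have hmeas : Measurable (D.indicator fun _ => (1 : ℝ)) := measurable_const.indicator hD
  have hX : ∀ {V : Type u} [MeasurableSpace V] (Q : Measure V) [IsProbabilityMeasure Q] (g : V → U),
      Measurable g → MemLp (fun v => D.indicator (fun _ => (1 : ℝ)) (g v)) 2 Q := fun Q _ g hg =>
    MemLp.of_bound (hmeas.comp hg).aestronglyMeasurable 1 (Eventually.of_forall fun v => by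
      by_cases h : g v ∈ D <;> simp [h])
  have hsum : MemLp (∑ j : Fin m, fun u : Fin m → U => D.indicator (fun _ => (1 : ℝ)) (u j)) 2
      (Measure.pi fun _ : Fin m => P) :=
    memLp_finsetSum' _ fun j _ => hX _ (fun u : Fin m → U => u j) (measurable_pi_apply j)
  have hvar := variance_sum_pi (μ := fun _ : Fin m => P)
    (X := fun _ => D.indicator fun _ => (1 : ℝ)) fun _ => hX P id measurable_id
  have hvar1 : Var[D.indicator fun _ => (1 : ℝ); P] ≤ 1 := by
    refine (variance_le_sq_of_bounded (a := 0) (b := 1) (Eventually.of_forall fun v => ?_)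
      hmeas.aemeasurable).trans (by norm_num)
    by_cases h : v ∈ D <;> simp [h]
  have hint : ∫ u, (∑ j : Fin m, fun u : Fin m → U => D.indicator (fun _ => (1 : ℝ)) (u j)) u
      ∂(Measure.pi fun _ : Fin m => P) = m * P.real D := by
    simp only [Finset.sum_apply]
    rw [integral_finsetSum _ fun j _ =>
      (hX (Measure.pi fun _ : Fin m => P) (fun u : Fin m → U => u j) (measurable_pi_apply j)).integrable
        (by norm_num)]
    have : ∀ j : Fin m, ∫ u : Fin m → U, D.indicator (fun _ => (1 : ℝ)) (u j)
        ∂(Measure.pi fun _ : Fin m => P) = P.real D := fun j => by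
      rw [integral_comp_eval (μ := fun _ : Fin m => P) (i := j) hmeas.aestronglyMeasurable,
        integral_indicator_const _ hD]
      simp
    simp [this]
  have hm' : (0 : ℝ) < m := by exact_mod_cast hm
  have hch := meas_ge_le_variance_div_sq hsum (c := m * η) (by positivity)
  rw [hint, hvar] at hch
  simp only [Finset.sum_apply] at hch
  refine hch.trans (ENNReal.ofReal_le_ofReal ?_)
  rw [div_le_div_iff₀ (by positivity) (by positivity), Finset.sum_const, Finset.card_univ,
    Fintype.card_fin, nsmul_eq_mul]
  have : (m : ℝ) * Var[D.indicator fun _ => (1 : ℝ); P] ≤ m * 1 := by gcongr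
  calc _ ≤ (m : ℝ) * 1 * (m * η ^ 2) := by gcongr
    _ = _ := by ring

/-- Continuity from above: the strips around c shrink to the null level set. -/
lemma exists_measure_near_level_lt {X : Type*} [MeasurableSpace X] (μ : Measure X)
    [IsFiniteMeasure μ] {g : X → ℝ} (hg : Measurable g) {c : ℝ} (hc : μ {x | g x = c} = 0)
    {δ : ℝ≥0∞} (hδ : 0 < δ) : ∃ η : ℝ, 0 < η ∧ μ {x | |g x - c| < η} < δ := by
  let F : ℕ → Set X := fun k => {x | |g x - c| < 1 / ((k : ℝ) + 1)}
  have hF : ∀ k, MeasurableSet (F k) := fun k =>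
    measurableSet_lt (hg.sub_const c).abs measurable_const
  have hanti : Antitone F := fun k l hkl x hx =>
    by
    have h : 1 / ((l : ℝ) + 1) ≤ 1 / ((k : ℝ) + 1) := by gcongr
    exact lt_of_lt_of_le hx h
  have hlim := tendsto_measure_iInter_atTop (μ := μ) (fun k => (hF k).nullMeasurableSet) hanti
    ⟨0, measure_ne_top _ _⟩
  have hI : ⋂ k, F k = {x | g x = c} := by
    ext x
    simp only [Set.mem_iInter, F, Set.mem_ofPred_eq]
    refine ⟨fun h => ?_, fun h k => by simp [h]; positivity⟩
    by_contra hne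
    obtain ⟨k, hk⟩ := exists_nat_one_div_lt (abs_pos.2 (sub_ne_zero.2 hne))
    exact absurd (h k) (not_lt.2 hk.le)
  rw [hI, hc] at hlim
  obtain ⟨k, hk⟩ := (hlim.eventually (gt_mem_nhds hδ)).exists
  exact ⟨1 / ((k : ℝ) + 1), by positivity, hk⟩

/-- A bounded function which is not almost surely equal to its mean has a nontrivial superlevel
set at a level which is attained with probability zero. -/
lemma exists_level {X : Type*} [MeasurableSpace X] (μ : Measure X) [IsProbabilityMeasure μ]
    {g : X → ℝ} (hg : Measurable g) (hgi : Integrable g μ) (hne : ¬ g =ᵐ[μ] fun _ => ∫ x, g x ∂μ) :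
    ∃ c : ℝ, μ {x | g x = c} = 0 ∧ 0 < μ {x | c < g x} ∧ μ {x | c < g x} < 1 := by
  set a := ∫ x, g x ∂μ with ha
  have hmeas : ∀ c, MeasurableSet {x | c < g x} := fun c => measurableSet_lt measurable_const hg
  have hpos : 0 < μ {x | a < g x} := by
    refine pos_iff_ne_zero.2 fun h0 => hne ?_
    have hle : g ≤ᵐ[μ] fun _ => a := by
      rw [EventuallyLE, ae_iff]
      simpa using h0
    exact (integral_eq_iff_of_ae_le hgi (integrable_const a) hle).1 (by simp [ha])
  have hlt : ∀ c, a ≤ c → μ {x | c < g x} < 1 := fun c hc => by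
    have h1 := measure_le_integral_pos hgi
    rw [← ha] at h1
    have h2 : {x | c < g x} ⊆ {x | g x ≤ a}ᶜ := fun x hx => by
      simpa using hc.trans_lt hx
    refine (measure_mono h2).trans_lt ?_
    rw [prob_compl_eq_one_sub (measurableSet_le hg measurable_const)]
    exact ENNReal.sub_lt_self ENNReal.one_ne_top one_ne_zero h1.ne'
  obtain ⟨b, hab, hb⟩ : ∃ b, a < b ∧ 0 < μ {x | b < g x} := by
    by_contra! h
    refine hpos.ne' ?_
    have hU : {x | a < g x} = ⋃ k : ℕ, {x | a + 1 / ((k : ℝ) + 1) < g x} := by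
      ext x
      simp only [Set.mem_ofPred_eq, Set.mem_iUnion]
      refine ⟨fun hx => ?_, fun ⟨k, hk⟩ => lt_trans (by simp; positivity) hk⟩
      obtain ⟨k, hk⟩ := exists_nat_one_div_lt (sub_pos.2 hx)
      exact ⟨k, by linarith⟩
    rw [hU, measure_iUnion_null_iff]
    exact fun k => nonpos_iff_eq_zero.1 (h _ (by simp; positivity))
  -- Only countably many levels have positive measure, so a null one lies between a and b.
  obtain ⟨c, hc, hac, hcb⟩ :=
    ((Measure.countable_meas_level_set_pos (μ := μ) hg).dense_compl ℝ).exists_between hab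
  refine ⟨c, by simpa using hc, hb.trans_le (measure_mono fun x hx => hcb.trans hx), hlt c hac.le⟩

/-! ### Transfer of entropy generating sequences -/

/-- If the entropies of `α` are controlled by those of `β` up to an arbitrarily small linear error,
then every entropy generating sequence of `α` generates entropy for `β`. -/
lemma IsEntropyGenerating.of_entropy_le {X Y : Type*} [MeasurableSpace X] [MeasurableSpace Y]
    {μ : Measure X} {ν : Measure Y} [IsProbabilityMeasure ν] {T : X → X} {S : Y → Y} {k l : ℕ} {α : X → Fin k}
    {β : Y → Fin l}
    (h : ∀ ε : ℝ, 0 < ε → ∃ m : ℕ, ∀ (s : ℕ → ℕ) (n : ℕ),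
      partitionEntropy μ (joinAlong T α s n) ≤
        m * partitionEntropy ν (joinAlong S β s n) + n * ε)
    {s : ℕ → ℕ} (hs : IsEntropyGenerating μ T α s) : IsEntropyGenerating ν S β s := by
  refine ⟨hs.1, ?_⟩
  obtain ⟨e, he0, he⟩ := exists_between hs.2
  have hetop : e ≠ ⊤ := he.ne_top
  have her : 0 < e.toReal := ENNReal.toReal_pos he0.ne' hetop
  obtain ⟨m, hm⟩ := h (e.toReal / 2) (by positivity)
  -- Half of the rate e absorbs the linear error and the other half is shared among the m copies; m
  -- + 1 avoids dividing by zero.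
  refine lt_of_lt_of_le (b := ENNReal.ofReal (e.toReal / 2 / (m + 1))) (by
    rw [ENNReal.ofReal_pos]; positivity) ?_
  refine le_liminf_of_le (by isBoundedDefault) ?_
  filter_upwards [eventually_lt_of_lt_liminf he, eventually_gt_atTop 0] with n hn hn0
  refine ENNReal.ofReal_le_ofReal ?_
  have hn0' : (0 : ℝ) < n := by exact_mod_cast hn0
  rw [← ENNReal.ofReal_toReal hetop, ENNReal.ofReal_lt_ofReal_iff_of_nonneg her.le,
    lt_div_iff₀ hn0'] at hn
  rw [div_le_div_iff₀ (by positivity) hn0']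
  have h1 := hm s n
  by_contra! hlt
  have h2 := partitionEntropy_nonneg ν (joinAlong S β s n)
  nlinarith

/-! ### Majority votes of conditionally independent copies -/

section Approximation

variable {X Y : Type*} [MeasurableSpace X] [MeasurableSpace Y] {μ : Measure X} {ν : Measure Y}

/-- The superlevel sets of the conditional probabilities of `B` are approximated by majority
votes among finitely many conditionally independent copies of the itinerary. -/
lemma exists_entropy_le [IsProbabilityMeasure μ] {T : X → X} (hT : MeasurePreserving T μ μ)
    {S : Y → Y} {B : Set Y}
    (κ : Kernel X (ℕ → Fin 2)) [IsMarkovKernel κ]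
    (hlaw : ∀ C, MeasurableSet C → ∫⁻ x, κ x C ∂μ = ν (itinerary S B ⁻¹' C))
    (hequiv : ∀ i, ∀ᵐ x ∂μ, κ x (zeroAt i) = κ (T^[i] x) (zeroAt 0)) {c : ℝ}
    (hc : μ {x | (κ x).real (zeroAt 0) = c} = 0) {ε : ℝ} (hε : 0 < ε) :
    ∃ m : ℕ, ∀ (s : ℕ → ℕ) (n : ℕ),
      partitionEntropy μ (joinAlong T (twoSetPartition {x | c < (κ x).real (zeroAt 0)}) s n) ≤
        m * partitionEntropy ν (joinAlong S (twoSetPartition B) s n) + n * ε := by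
  set g : X → ℝ := fun x => (κ x).real (zeroAt 0) with hg_def
  have hg : Measurable g := (κ.measurable_coe (measurableSet_zeroAt 0)).ennreal_toReal
  have hA : MeasurableSet {x | c < g x} := measurableSet_lt measurable_const hg
  obtain ⟨δ, hδ, hδε⟩ : ∃ δ : ℝ, 0 < δ ∧ ∀ p, 0 ≤ p → p < δ → Real.binEntropy p ≤ ε := by
    have h := Metric.continuousAt_iff.1 (Real.binEntropy_continuous.continuousAt (x := 0)) ε hε
    obtain ⟨δ, hδ, h⟩ := h
    refine ⟨δ, hδ, fun p hp hpδ => ?_⟩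
    have := h (x := p) (by simpa [abs_of_nonneg hp] using hpδ)
    rw [Real.binEntropy_zero, Real.dist_eq, sub_zero] at this
    exact (le_abs_self _).trans this.le
  -- The error budget δ is split: half for g being within η of c, half for the Chebyshev bound
  -- 1/(mη²).
  obtain ⟨η, hη, hμη⟩ := exists_measure_near_level_lt μ hg hc
    (δ := ENNReal.ofReal (δ / 2)) (by simpa using hδ)
  obtain ⟨m, hm⟩ := exists_nat_gt (2 / (δ * η ^ 2))
  have hm0 : (0 : ℝ) < m := lt_of_le_of_lt (by positivity) hm
  have hmδ : 1 / (m * η ^ 2) ≤ δ / 2 := by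
    rw [div_lt_iff₀ (by positivity)] at hm
    rw [div_le_div_iff₀ (by positivity) (by positivity)]
    linarith
  refine ⟨m, fun s n => ?_⟩
  -- Each κ x is the image of Lebesgue measure under `f x`, so m independent uniform variables yield
  -- the copies.
  obtain ⟨f, hf, hfκ⟩ := Kernel.exists_measurable_map_eq_unitInterval κ
  let I := unitInterval
  let Q : Measure (Fin m → I) := Measure.pi fun _ => volume
  let ρ : Measure (X × (Fin m → I)) := μ.prod Q
  have hfx : ∀ x, Measurable (f x) := fun x => hf.of_uncurry_left
  have hfj : ∀ j : Fin m, Measurable fun z : X × (Fin m → I) => f z.1 (z.2 j) := fun j =>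
    hf.comp (measurable_fst.prodMk ((measurable_pi_apply j).comp measurable_snd))
  let word : (ℕ → Fin 2) → Fin n → Fin 2 := fun w i => w (s i)
  have hword : Measurable word := measurable_pi_lambda _ fun i => measurable_pi_apply _
  let R : Fin m → X × (Fin m → I) → Fin n → Fin 2 := fun j z => word (f z.1 (z.2 j))
  have hR : ∀ j, Measurable (R j) := fun j => hword.comp (hfj j)
  let P : X × (Fin m → I) → Fin n → Fin 2 :=
    fun z => joinAlong T (twoSetPartition {x | c < g x}) s n z.1
  have hJ := measurable_joinAlong hT.measurable (measurable_twoSetPartition hA) s n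
  have hP : Measurable P := hJ.comp measurable_fst
  let Φ : (Fin m → Fin n → Fin 2) → Fin n → Fin 2 := fun w i =>
    if m * c < ∑ j, (if w j i = 0 then (1 : ℝ) else 0) then 0 else 1
  have hHP : partitionEntropy ρ P =
      partitionEntropy μ (joinAlong T (twoSetPartition {x | c < g x}) s n) := by
    refine partitionEntropy_congr _ fun a => ?_
    have : P ⁻¹' {a} = (joinAlong T (twoSetPartition {x | c < g x}) s n ⁻¹' {a}) ×ˢ Set.univ := by
      ext z
      simp [P]
    rw [this, Measure.prod_prod]
    simp
  have hHR : ∀ j, partitionEntropy ρ (R j) =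
      partitionEntropy ν (joinAlong S (twoSetPartition B) s n) := fun j => by
    refine partitionEntropy_congr _ fun a => ?_
    have hC : MeasurableSet (word ⁻¹' {a}) := hword (measurableSet_singleton a)
    have h1 : joinAlong S (twoSetPartition B) s n ⁻¹' {a} = itinerary S B ⁻¹' (word ⁻¹' {a}) := rfl
    rw [h1, ← hlaw _ hC, Measure.prod_apply (hR j (measurableSet_singleton a))]
    refine lintegral_congr fun x => ?_
    rw [← hfκ x, Measure.map_apply (hfx x) hC]
    exact (measurePreserving_eval (fun _ : Fin m => (volume : Measure I)) j).measure_preimage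
      (hfx x hC).nullMeasurableSet
  have hE : ∀ i : Fin n, ρ.real {z | P z i ≠ Φ (fun j => R j z) i} < δ := fun i => by
    let D : X → Set I := fun x => f x ⁻¹' zeroAt (s i)
    let near : Set X := T^[s i] ⁻¹' {x | |g x - c| < η}
    let far : Set (X × (Fin m → I)) := {z | m * η ≤
      |(∑ j, (D z.1).indicator (fun _ => (1 : ℝ)) (z.2 j)) - m * (κ z.1).real (zeroAt (s i))|}
    have hind : ∀ (z : X × (Fin m → I)) (j : Fin m),
        (D z.1).indicator (fun _ => (1 : ℝ)) (z.2 j) =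
          (zeroAt (s i)).indicator (fun _ => (1 : ℝ)) (f z.1 (z.2 j)) := fun z j => rfl
    have hfar : MeasurableSet far := by
      have h1 : Measurable fun z : X × (Fin m → I) => (κ z.1).real (zeroAt (s i)) :=
        ((κ.measurable_coe (measurableSet_zeroAt (s i))).ennreal_toReal).comp measurable_fst
      have h2 : Measurable fun z : X × (Fin m → I) =>
          ∑ j, (D z.1).indicator (fun _ => (1 : ℝ)) (z.2 j) := by
        simp only [hind]
        exact Finset.measurable_sum _ fun j _ =>
          (measurable_const.indicator (measurableSet_zeroAt (s i))).comp (hfj j)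
      exact measurableSet_le measurable_const (h2.sub (h1.const_mul _)).abs
    -- Invariance of μ makes this bound independent of the time `s i`.
    have hnear_le : ρ (near ×ˢ Set.univ) < ENNReal.ofReal (δ / 2) := by
      rw [Measure.prod_prod, (hT.iterate (s i)).measure_preimage
        (measurableSet_lt (hg.sub_const c).abs measurable_const).nullMeasurableSet]
      simpa using hμη
    have hfar_le : ρ far ≤ ENNReal.ofReal (δ / 2) := by
      rw [Measure.prod_apply hfar]
      refine (lintegral_mono (g := fun _ => ENNReal.ofReal (δ / 2)) fun x => ?_).trans (by simp)
      have hD : MeasurableSet (D x) := hfx x (measurableSet_zeroAt _)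
      have h1 := measure_pi_frequency_le (volume : Measure I) hD (m := m)
        (by exact_mod_cast hm0) hη
      have h2 : (volume : Measure I).real (D x) = (κ x).real (zeroAt (s i)) := by
        rw [← hfκ x, map_measureReal_apply (hfx x) (measurableSet_zeroAt _)]
      rw [h2] at h1
      exact h1.trans (ENNReal.ofReal_le_ofReal hmδ)
    have hae : ∀ᵐ z ∂ρ, κ z.1 (zeroAt (s i)) = κ (T^[s i] z.1) (zeroAt 0) :=
      Measure.quasiMeasurePreserving_fst.ae (hequiv (s i))
    have hsub : ρ {z | P z i ≠ Φ (fun j => R j z) i} ≤ ρ (near ×ˢ Set.univ ∪ far) := by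
      refine measure_mono_ae ?_
      filter_upwards [hae] with z hz
      intro hPz
      by_contra hcon
      change ¬ (z ∈ near ×ˢ Set.univ ∪ far) at hcon
      change P z i ≠ Φ (fun j => R j z) i at hPz
      simp only [Set.mem_union, not_or, Set.mem_prod, Set.mem_univ, and_true] at hcon
      obtain ⟨hn, hfz⟩ := hcon
      have hq : (κ z.1).real (zeroAt (s i)) = g (T^[s i] z.1) := by
        rw [hg_def]; simp only [Measure.real, hz]
      simp only [far, Set.mem_ofPred_eq, not_le, hq] at hfz
      have hn' : η ≤ |g (T^[s i] z.1) - c| := not_lt.1 hn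
      have hsum : ∑ j, (if R j z i = 0 then (1 : ℝ) else 0) =
          ∑ j, (D z.1).indicator (fun _ => (1 : ℝ)) (z.2 j) :=
        Finset.sum_congr rfl fun j _ => by
          rw [hind]
          simp only [Set.indicator, zeroAt, Set.mem_ofPred_eq, R, word]
          congr
      apply hPz
      have hPi : P z i = if c < g (T^[s i] z.1) then 0 else 1 := by
        simp only [P, joinAlong, twoSetPartition, Set.mem_ofPred_eq]
      rw [hPi]
      simp only [Φ]
      rw [hsum]
      refine if_congr ?_ rfl rfl
      -- Since |σ - mq| < mη ≤ m|q - c|, the count σ and mq lie on the same side of mc.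
      generalize (∑ j, (D z.1).indicator (fun _ => (1 : ℝ)) (z.2 j)) = σ at hfz ⊢
      generalize g (T^[s i] z.1) = q at hfz hn' ⊢
      rw [abs_lt] at hfz
      constructor
      · intro hcq
        rw [abs_of_pos (sub_pos.2 hcq)] at hn'
        nlinarith
      · intro hcσ
        by_contra! hqc
        rw [abs_of_nonpos (sub_nonpos.2 hqc)] at hn'
        nlinarith
    have htot : ρ {z | P z i ≠ Φ (fun j => R j z) i} < ENNReal.ofReal δ := by
      refine hsub.trans_lt ((measure_union_le _ _).trans_lt ?_)
      rw [← add_halves δ, ENNReal.ofReal_add (by positivity) (by positivity)]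
      exact ENNReal.add_lt_add_of_lt_of_le (measure_ne_top _ _) hnear_le hfar_le
    exact (ENNReal.lt_ofReal_iff_toReal_lt htot.ne_top).1 htot
  have key := partitionEntropy_le_of_approx ρ hP hR Φ
  simp only [hHR] at key
  rw [hHP] at key
  refine key.trans ?_
  have h2 := Finset.sum_le_sum fun (i : Fin n) (_ : i ∈ Finset.univ) =>
    hδε _ measureReal_nonneg (hE i)
  simp only [Finset.sum_const, Finset.card_univ, Fintype.card_fin, nsmul_eq_mul] at h2 ⊢
  linarith

end Approximation

/-! ### Joinings are products -/

/-- If every element of the dimension set of `(X, μ, T)` exceeds the upper entropy dimension of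
`(Y, ν, S)`, then every joining of the two systems is the product measure. -/
lemma IsJoining.eq_prod {X Y : Type*} [MeasurableSpace X] [MeasurableSpace Y] {μ : Measure X}
    [IsProbabilityMeasure μ] {ν : Measure Y} [IsProbabilityMeasure ν] {T : X ≃ᵐ X}
    (hT : MeasurePreserving T μ μ) {S : Y → Y} (hS : Measurable S) {lam : Measure (X × Y)}
    (hlam : IsJoining μ T ν S lam)
    (hdim : ∀ τ ∈ dimensionSet μ T, upperEntropyDim ν S < τ) : lam = μ.prod ν := by
  have := hlam.isProbabilityMeasure
  refine (Measure.prod_eq fun A B hA hB => ?_).symm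
  obtain ⟨κ, _, hκ⟩ := exists_kernel_itinerary hlam hS hB
  have hB0 : itinerary S B ⁻¹' zeroAt 0 = B := by
    rw [itinerary_preimage_zeroAt, Function.iterate_zero, Set.preimage_id]
  have hlaw : ∀ C, MeasurableSet C → ∫⁻ x, κ x C ∂μ = ν (itinerary S B ⁻¹' C) := fun C hC => by
    have hC' := measurable_itinerary hS hB hC
    rw [← setLIntegral_univ, hκ _ MeasurableSet.univ _ hC, ← hlam.map_snd,
      Measure.map_apply measurable_snd hC', Set.univ_prod]
  let g : X → ℝ := fun x => (κ x).real (zeroAt 0)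
  have hg : Measurable g := (κ.measurable_coe (measurableSet_zeroAt 0)).ennreal_toReal
  have hgi : Integrable g μ := Integrable.of_bound hg.aestronglyMeasurable 1
    (Eventually.of_forall fun x => by
      simp [g, abs_of_nonneg measureReal_nonneg, measureReal_le_one])
  have hint : ∫ x, g x ∂μ = ν.real B := by
    have := integral_toReal (κ.measurable_coe (measurableSet_zeroAt 0)).aemeasurable
      (Eventually.of_forall fun x => measure_lt_top (κ x) (zeroAt 0)) (μ := μ)
    rw [hlaw _ (measurableSet_zeroAt 0), hB0] at this
    exact this
  by_cases hconst : g =ᵐ[μ] fun _ => ∫ x, g x ∂μ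
  · have h1 := hκ A hA _ (measurableSet_zeroAt 0)
    rw [hB0] at h1
    have h2 : ∀ᵐ x ∂μ, κ x (zeroAt 0) = ν B := by
      filter_upwards [hconst] with x hx
      rw [hint] at hx
      exact (ENNReal.toReal_eq_toReal_iff' (measure_ne_top _ _) (measure_ne_top _ _)).1 hx
    rw [← h1, setLIntegral_congr_fun_ae hA (h2.mono fun x hx _ => hx), setLIntegral_const, mul_comm]
  · exfalso
    obtain ⟨c, hc, hpos, hlt⟩ := exists_level μ hg hgi hconst
    have hent := fun ε (hε : 0 < ε) => exists_entropy_le (T := T) hT κ hlaw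
      (kernel_itinerary_equivariant hT hlam hB hκ) hc hε
    have hle : upperEntropyDimPartition μ T (twoSetPartition {x | c < g x}) ≤
        upperEntropyDim ν S := by
      refine le_trans ?_ (le_iSup_of_le 2 (le_iSup₂_of_le (twoSetPartition B)
        (measurable_twoSetPartition hB) le_rfl))
      exact iSup₂_le fun s hs => le_iSup₂_of_le s (hs.of_entropy_le hent) le_rfl
    exact absurd (hdim _ ⟨_, measurableSet_lt measurable_const hg, hpos, hlt, rfl⟩) (not_lt.2 hle)

end EntropyDimension

theorem mainTheorem3 {X : Type*} [MeasurableSpace X] (μ : Measure X)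
    [IsProbabilityMeasure μ] (T : X ≃ᵐ X) (hT : MeasurePreserving T μ μ)
    {Y : Type*} [MeasurableSpace Y] (ν : Measure Y) [IsProbabilityMeasure ν]
    (S : Y → Y) (hS : Ergodic S ν)
    (hdim : ∀ τ ∈ EntropyDimension.dimensionSet μ T, EntropyDimension.upperEntropyDim ν S < τ) :
    EntropyDimension.AreDisjoint μ T ν S := by
  refine Set.eq_singleton_iff_unique_mem.2
    ⟨⟨inferInstance, hT.prod hS.toMeasurePreserving, ?_, ?_⟩, fun lam hlam =>
      hlam.eq_prod hT hS.measurable hdim⟩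
  · simp
  · simp
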